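/- For a finite connected simple undirected graph $G$ with path metric $d_G$, and integers $k,\ell\ge 0$, let $\mathrm{EMC}_{k,\ell}(G;\mathbb{Z})$ be the free abelian group on the tuples $(x_0,\dots,x_k)$ of pairwise distinct vertices of $G$ of length $\sum_{i=0}^{k-1} d_G(x_i,x_{i+1})=\ell$. Let $\partial\colon \mathrm{EMC}_{k,\ell}(G;\mathbb{Z})\to\mathrm{EMC}_{k-1,\ell}(G;\mathbb{Z})$ be the differential $\partial=\sum_{i=1}^{k-1}(-1)^i\partial_i$, where $\partial_i(x_0,\dots,x_k)=(x_0,\dots,x_{i-1},x_{i+1},\dots,x_k)$ if this tuple still has length $\ell$, and $\partial_i(x_0,\dots,x_k)=0$ otherwise. The integral eulerian magnitude homology of $G$ is the bigraded abelian group \[ \mathrm{EMH}(G;\mathbb{Z})=\bigoplus_{k,\ell\ge 0}\mathrm{EMH}_{k,\ell}(G;\mathbb{Z}),\qquad \mathrm{EMH}_{k,\ell}(G;\mathbb{Z})=H_k(\mathrm{EMC}_{*,\ell}(G;\mathbb{Z}),\partial). \] Proposition. Let $A$ be any finitely generated abelian group. Then there exists a finite connected simple undirected graph $G$ whose integral eulerian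 magnitude homology $\mathrm{EMH}(G;\mathbb{Z})$ contains a subgroup isomorphic to $A$. -/

import Mathlib

noncomputable section

open scoped DirectSum

namespace EulerianMagnitude

universe u v

variable {V : Type*}

/-- The length `∑ d_G(x_i, x_{i+1})` of a tuple `(x_0, …, x_k)` for the path metric of `G`, with
value `⊤` when two consecutive vertices are not joined by a path. -/
def len (G : SimpleGraph V) {k : ℕ} (x : Fin (k + 1) → V) : ℕ∞ :=
  ∑ i : Fin k, G.edist (x i.castSucc) (x i.succ)

/-- The generators of `EMC_{k,l}(G)`: tuples `(x_0, …, x_k)` of pairwise distinct vertices, of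
(finite) length `l`. -/
abbrev Generator (G : SimpleGraph V) (k l : ℕ) : Type _ :=
  {x : Fin (k + 1) → V // Function.Injective x ∧ len G x = (l : ℕ∞)}

/-- The eulerian magnitude chains `EMC_{k,l}(G; R)`: the free `R`-module on the generators. -/
abbrev EMC (R : Type*) [CommRing R] (G : SimpleGraph V) (k l : ℕ) : Type _ :=
  Generator G k l →₀ R

/-- The inner positions `1, …, k` among the positions `0, …, k + 1` of a `(k + 2)`-tuple. -/
def innerPos {k : ℕ} (j : Fin k) : Fin (k + 2) := j.succ.castSucc

/-- The tuple with the entry at the inner position `j + 1` deleted. -/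
def del {k : ℕ} (j : Fin k) (x : Fin (k + 2) → V) : Fin (k + 1) → V :=
  fun i => x ((innerPos j).succAbove i)

theorem del_injective {k : ℕ} (j : Fin k) {x : Fin (k + 2) → V} (hx : Function.Injective x) :
    Function.Injective (del j x) :=
  hx.comp Fin.succAbove_right_injective

open Classical in
/-- The face of a generator at the inner position `j + 1`: delete the entry if the length is
preserved, and `0` otherwise. -/
def faceGen (R : Type*) [CommRing R] (G : SimpleGraph V) {k l : ℕ} (j : Fin k)
    (x : Generator G (k + 1) l) : EMC R G k l :=
  if h : len G (del j x.1) = (l : ℕ∞) then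
    Finsupp.single ⟨del j x.1, del_injective j x.2.1, h⟩ 1
  else 0

/-- The face map on chains, extended linearly. -/
def face (R : Type*) [CommRing R] (G : SimpleGraph V) {k l : ℕ} (j : Fin k) :
    EMC R G (k + 1) l →ₗ[R] EMC R G k l :=
  Finsupp.linearCombination R (faceGen R G j)

/-- The differential `EMC_{k+1,l} → EMC_{k,l}`, `∂ = ∑_{i=1}^{k} (-1)^i ∂_i`, where `i = j + 1`. -/
def d (R : Type*) [CommRing R] (G : SimpleGraph V) (k l : ℕ) :
    EMC R G (k + 1) l →ₗ[R] EMC R G k l :=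
  ∑ j : Fin k, (-1 : R) ^ ((j : ℕ) + 1) • face R G j

theorem val_succAbove {n : ℕ} (p : Fin (n + 1)) (i : Fin n) :
    (p.succAbove i : ℕ) = if (i : ℕ) < p then (i : ℕ) else i + 1 := by
  simp only [Fin.succAbove, Fin.lt_def, Fin.val_castSucc]
  split_ifs <;> simp

theorem val_predAbove {n : ℕ} (p : Fin n) (i : Fin (n + 1)) :
    (p.predAbove i : ℕ) = if (p : ℕ) < i then (i : ℕ) - 1 else i := by
  by_cases h : (p : ℕ) < i
  · rw [if_pos h, Fin.predAbove_of_castSucc_lt p i h, Fin.val_pred]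
  · rw [if_neg h, Fin.predAbove_of_le_castSucc p i (not_lt.1 h), Fin.coe_castPred]

theorem val_innerPos {k : ℕ} (j : Fin k) : (innerPos j : ℕ) = j + 1 := rfl

/-- Deleting an inner entry does not increase the length. -/
theorem len_del_le (G : SimpleGraph V) {k : ℕ} (j : Fin k) (x : Fin (k + 2) → V) :
    len G (del j x) ≤ len G x := by
  have key : ∀ i : Fin k, G.edist (del j x i.castSucc) (del j x i.succ) ≤
      (if i = j then G.edist (x j.castSucc.castSucc) (x j.castSucc.succ) else 0) +
        G.edist (x (j.castSucc.succAbove i).castSucc) (x (j.castSucc.succAbove i).succ) := by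
    intro i
    rcases lt_trichotomy i j with h | h | h
    · have e1 : (innerPos j).succAbove i.castSucc = (j.castSucc.succAbove i).castSucc := by
        rw [Fin.lt_def] at h; ext; simp only [val_succAbove, val_innerPos, Fin.val_castSucc, Fin.val_succ]; grind
      have e2 : (innerPos j).succAbove i.succ = (j.castSucc.succAbove i).succ := by
        rw [Fin.lt_def] at h; ext; simp only [val_succAbove, val_innerPos, Fin.val_castSucc, Fin.val_succ]; grind
      simp [del, e1, e2]
    · subst h
      have e1 : (innerPos i).succAbove i.castSucc = i.castSucc.castSucc := by
        ext; simp only [val_succAbove, val_innerPos, Fin.val_castSucc, Fin.val_succ]; grind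
      have e2 : (innerPos i).succAbove i.succ = (i.castSucc.succAbove i).succ := by
        ext; simp only [val_succAbove, val_innerPos, Fin.val_castSucc, Fin.val_succ]; grind
      have e3 : (i.castSucc.succAbove i).castSucc = i.castSucc.succ := by
        ext; simp only [val_succAbove, val_innerPos, Fin.val_castSucc, Fin.val_succ]; grind
      simp only [del, e1, e2, e3, if_true]
      exact G.edist_triangle
    · have e1 : (innerPos j).succAbove i.castSucc = (j.castSucc.succAbove i).castSucc := by
        rw [Fin.lt_def] at h; ext; simp only [val_succAbove, val_innerPos, Fin.val_castSucc, Fin.val_succ]; grind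
      have e2 : (innerPos j).succAbove i.succ = (j.castSucc.succAbove i).succ := by
        rw [Fin.lt_def] at h; ext; simp only [val_succAbove, val_innerPos, Fin.val_castSucc, Fin.val_succ]; grind
      simp [del, e1, e2]
  calc len G (del j x) ≤ _ := Finset.sum_le_sum fun i _ => key i
    _ = len G x := by
      rw [Finset.sum_add_distrib, len, Fin.sum_univ_succAbove _ j.castSucc]
      simp

theorem innerPos_succAbove {k : ℕ} (i : Fin (k + 1)) (j : Fin k) :
    (innerPos i).succAbove (innerPos j) = innerPos (i.succAbove j) := by
  ext; simp only [val_succAbove, val_innerPos, Fin.val_castSucc, Fin.val_succ]; grind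

/-- Two inner entries can be deleted in either order. -/
theorem del_del {k : ℕ} (i : Fin (k + 1)) (j : Fin k) (x : Fin (k + 3) → V) :
    del (j.predAbove i) (del (i.succAbove j) x) = del j (del i x) := by
  funext a
  simp only [del]
  congr 1
  ext
  simp only [val_predAbove, val_succAbove, val_innerPos, Fin.val_castSucc, Fin.val_succ]
  grind

open Classical in
theorem face_faceGen (R : Type*) [CommRing R] (G : SimpleGraph V) {k l : ℕ} (i : Fin (k + 1))
    (j : Fin k) (x : Generator G (k + 2) l) :
    face R G j (faceGen R G i x) =
      if h : len G (del j (del i x.1)) = (l : ℕ∞) then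
        Finsupp.single ⟨del j (del i x.1), del_injective j (del_injective i x.2.1), h⟩ 1
      else 0 := by
  by_cases h1 : len G (del i x.1) = (l : ℕ∞)
  · rw [faceGen, dif_pos h1, face, Finsupp.linearCombination_single, one_smul, faceGen]
  · have h2 : ¬ len G (del j (del i x.1)) = (l : ℕ∞) := fun h2 =>
      h1 (le_antisymm ((len_del_le G i x.1).trans_eq x.2.2) (h2.symm.trans_le (len_del_le G j (del i x.1))))
    rw [faceGen, dif_neg h1, map_zero, dif_neg h2]

/-- The eulerian magnitude chains form a chain complex. -/
theorem d_comp_d (R : Type*) [CommRing R] (G : SimpleGraph V) (k l : ℕ) :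
    d R G k l ∘ₗ d R G (k + 1) l = 0 := by
  refine Finsupp.lhom_ext' fun x => LinearMap.ext_ring ?_
  have hx : ∀ i : Fin (k + 1), face R G i (Finsupp.single x 1) = faceGen R G i x := by
    intro i; simp [face]
  simp only [LinearMap.comp_apply, Finsupp.lsingle_apply, LinearMap.zero_apply, d,
    LinearMap.sum_apply, LinearMap.smul_apply, hx, map_sum, map_smul, Finset.smul_sum, smul_smul]
  rw [← Finset.sum_product']
  have hF : ∀ p : Fin (k + 1) × Fin k,
      face R G (p.2.predAbove p.1) (faceGen R G (p.1.succAbove p.2) x) =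
        face R G p.2 (faceGen R G p.1 x) := by
    rintro ⟨i, j⟩
    simp only [face_faceGen, del_del]
  have hs : ∀ p : Fin (k + 1) × Fin k,
      (-1 : R) ^ ((p.1.succAbove p.2 : ℕ) + 1) * (-1) ^ ((p.2.predAbove p.1 : ℕ) + 1) =
        -((-1) ^ ((p.1 : ℕ) + 1) * (-1) ^ ((p.2 : ℕ) + 1)) := by
    rintro ⟨i, j⟩
    have := Fin.neg_one_pow_succAbove_add_predAbove (R := R) i j
    rw [pow_add, pow_add] at this
    simp only [pow_succ]
    linear_combination this
  refine Finset.sum_involution (fun p _ => (p.1.succAbove p.2, p.2.predAbove p.1)) ?_ ?_ ?_ ?_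
  · intro p _
    simp only [hF, hs, neg_smul, add_neg_cancel]
  · rintro ⟨i, j⟩ _ _ h
    exact Fin.succAbove_ne i j (congrArg Prod.fst h)
  · simp
  · rintro ⟨i, j⟩ _
    ext <;> simp only [val_predAbove, val_succAbove] <;> grind

/-- The eulerian magnitude chain complex `EMC_{*,l}(G; R)`. -/
def complex (R : Type v) [CommRing R] {V : Type u} (G : SimpleGraph V) (l : ℕ) :
    ChainComplex (ModuleCat.{max u v} R) ℕ :=
  ChainComplex.of (fun k => ModuleCat.of R (EMC R G k l)) (fun k => ModuleCat.ofHom (d R G k l))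
    (fun k => by rw [← ModuleCat.ofHom_comp, d_comp_d]; rfl)

/-- The eulerian magnitude homology `EMH_{k,l}(G; R) = H_k(EMC_{*,l}(G; R))`. -/
abbrev EMH (R : Type v) [CommRing R] {V : Type u} (G : SimpleGraph V) (k l : ℕ) :
    ModuleCat.{max u v} R :=
  (complex R G l).homology k

/-- The bigraded eulerian magnitude homology `EMH(G; R) = ⨁_{k,l ≥ 0} EMH_{k,l}(G; R)`. -/
abbrev TotalEMH (R : Type v) [CommRing R] {V : Type u} (G : SimpleGraph V) : Type (max u v) :=
  ⨁ p : ℕ × ℕ, EMH R G p.1 p.2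

end EulerianMagnitude

end

/-!
In the Hasse diagram of a graded poset, the tuples from `a` to `b` whose length is the difference
of the grades are exactly the strictly increasing ones, and no deletion of an inner entry changes
their length. In this length the eulerian magnitude chains from `a` to `b` are therefore the
augmented simplicial chains, shifted by two, of the order complex of the open interval between `a`
and `b`, so the eulerian magnitude homology contains the reduced homology of that order complex.

For a finite abelian group `B`, translation acts freely on the simply connected join `B * B * B`,
so the quotient has first homology `B`. Adding a least and a greatest element to its face poset
gives a graph with `B` inside `EMH_{3,4}`. As `EMH_{0,0}` is free on the vertices, a large enough
`B` provides the free part of a finitely generated abelian group as well.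
-/

noncomputable section

open CategoryTheory SimpleGraph
open scoped DirectSum

namespace EulerianMagnitude

universe u v

section Homology

variable {R : Type v} [Ring R] {ι : Type*} {c : ComplexShape ι}
  (K : HomologicalComplex (ModuleCat.{u} R) c) {i j k : ι}

/-- The homology classes of the cycles of a complex of modules, as a linear map on the kernel of
the differential leaving degree `j`. -/
def homologyClass (hk : c.next j = k) : LinearMap.ker (K.d j k).hom →ₗ[R] K.homology j :=
  (K.liftCycles (ModuleCat.ofHom (LinearMap.ker (K.d j k).hom).subtype) k hk
    (by ext x; exact x.2) ≫ K.homologyπ j).hom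

theorem homologyClass_eq_zero_iff (hi : c.prev j = i) (hk : c.next j = k)
    (z : LinearMap.ker (K.d j k).hom) :
    homologyClass K hk z = 0 ↔ (z : K.X j) ∈ LinearMap.range (K.d i j).hom := by
  subst hi
  have hι : K.homologyι j (homologyClass K hk z) = K.pOpcycles j z := by
    rw [homologyClass, ← ConcreteCategory.comp_apply]
    simp
  rw [← map_eq_zero_iff (K.homologyι j).hom
    ((ModuleCat.mono_iff_injective (K.homologyι j)).1 inferInstance)]
  exact (Eq.congr_left hι).trans ((K.sc j).moduleCat_pOpcycles_eq_zero_iff z.1)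

end Homology

section Chains

variable {R : Type v} [CommRing R] {V : Type u} {G : SimpleGraph V}

theorem complex_d (k l : ℕ) : ((complex R G l).d (k + 1) k).hom = d R G k l :=
  congrArg ModuleCat.Hom.hom (ChainComplex.of_d (fun k => ModuleCat.of R (EMC R G k l))
    (fun k => ModuleCat.ofHom (d R G k l)) k)

variable (R G) in
/-- The eulerian magnitude homology classes of the cycles in positive degree. -/
def emhClass (k l : ℕ) : LinearMap.ker (d R G k l) →ₗ[R] EMH R G (k + 1) l :=
  homologyClass (complex R G l) (ChainComplex.next_nat_succ k) ∘ₗ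
    Submodule.inclusion (congrArg LinearMap.ker (complex_d k l)).ge

theorem emhClass_eq_zero_iff {k l : ℕ} (z : LinearMap.ker (d R G k l)) :
    emhClass R G k l z = 0 ↔ (z : EMC R G (k + 1) l) ∈ LinearMap.range (d R G (k + 1) l) := by
  rw [← complex_d (k + 1) l]
  exact homologyClass_eq_zero_iff _ (ChainComplex.prev ℕ (k + 1)) _ _

variable (R G) in
/-- There is no inner entry to delete in degrees `0` and `1`, so that `EMH_{0,l}` is the module of
all chains. -/
def homologyZeroEquiv (l : ℕ) : EMC R G 0 l ≃ₗ[R] EMH R G 0 l :=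
  ((complex R G l).pOpcyclesIso 1 0 (by simp)
      (ModuleCat.hom_ext ((complex_d 0 l).trans (Finset.sum_of_isEmpty _))) ≪≫
    ((complex R G l).isoHomologyι₀).symm).toLinearEquiv

variable (G) in
/-- The generators of degree and length `0` are the vertices. -/
def generatorZeroEquiv : Generator G 0 0 ≃ V where
  toFun x := x.1 0
  invFun v := ⟨fun _ => v, fun _ _ _ => Subsingleton.elim (α := Fin 1) _ _, by simp [len]⟩
  left_inv x := Subtype.ext (funext fun i => congrArg x.1 (Subsingleton.elim (α := Fin 1) 0 i))
  right_inv _ := rfl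

variable (R G) in
/-- `EMH_{0,0}` is free on the vertices. -/
def vertexHomologyEquiv : (V →₀ R) ≃ₗ[R] EMH R G 0 0 :=
  Finsupp.domLCongr (generatorZeroEquiv G).symm ≪≫ₗ homologyZeroEquiv R G 0

open Classical in
variable (R G) in
/-- The chain of a tuple, with value `0` unless the tuple is a generator. -/
def tupleChain {k : ℕ} (l : ℕ) (x : Fin (k + 1) → V) : EMC R G k l :=
  if h : Function.Injective x ∧ len G x = (l : ℕ∞) then Finsupp.single ⟨x, h⟩ 1 else 0

variable (R) in
theorem tupleChain_coe {k l : ℕ} (x : Generator G k l) :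
    tupleChain R G l x.1 = Finsupp.single x 1 :=
  dif_pos x.2

variable (R) in
theorem d_tupleChain {k l : ℕ} {x : Fin (k + 2) → V}
    (hx : Function.Injective x ∧ len G x = l) :
    d R G k l (tupleChain R G l x) =
      ∑ j : Fin k, (-1 : R) ^ ((j : ℕ) + 1) • tupleChain R G l (del j x) := by
  rw [tupleChain, dif_pos hx]
  simp only [d, face, faceGen, tupleChain, LinearMap.sum_apply, LinearMap.smul_apply,
    Finsupp.linearCombination_single, one_smul, del_injective _ hx.1, true_and]

theorem del_apply_zero {k : ℕ} (j : Fin k) (x : Fin (k + 2) → V) : del j x 0 = x 0 :=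
  congrArg x (Fin.succAbove_ne_zero_zero (by simp [innerPos]))

theorem del_apply_last {k : ℕ} (j : Fin k) (x : Fin (k + 2) → V) :
    del j x (Fin.last k) = x (Fin.last (k + 1)) :=
  congrArg x (Fin.succAbove_ne_last_last (by simp [innerPos, Fin.ext_iff]; lia))

theorem strictMono_del [Preorder V] {k : ℕ} (j : Fin k) {x : Fin (k + 2) → V} (hx : StrictMono x) :
    StrictMono (del j x) :=
  hx.comp (Fin.strictMono_succAbove _)

theorem len_eq_edist_add {k : ℕ} (x : Fin (k + 2) → V) :
    len G x = G.edist (x 0) (x 1) + len G (fun i => x i.succ) :=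
  Fin.sum_univ_succ _

end Chains

section Cochain

variable {R : Type v} [CommRing R] {N : Type*} [AddCommGroup N] [Module R N] {V : Type u}
  {G : SimpleGraph V}

open Classical in
variable (R G) in
/-- The cochain with the values of `φ` on the tuples from `a` to `b`, and `0` on all others. -/
def intervalCochain {k : ℕ} (l : ℕ) (a b : V) (φ : (Fin (k + 1) → V) → N) :
    EMC R G k l →ₗ[R] N :=
  Finsupp.linearCombination R fun x : Generator G k l =>
    if x.1 0 = a ∧ x.1 (Fin.last k) = b then φ x.1 else 0

open Classical in
theorem intervalCochain_tupleChain {k l : ℕ} {a b : V} (φ : (Fin (k + 1) → V) → N)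
    {x : Fin (k + 1) → V} (hx : Function.Injective x ∧ len G x = l) :
    intervalCochain R G l a b φ (tupleChain R G l x) =
      if x 0 = a ∧ x (Fin.last k) = b then φ x else 0 := by
  rw [tupleChain, dif_pos hx, intervalCochain, Finsupp.linearCombination_single, one_smul]

end Cochain

section GradedOrder

variable {P : Type u} [PartialOrder P] [GradeOrder ℕ P]

theorem grade_le_grade_add_length {x y : P} (w : (hasse P).Walk x y) :
    grade ℕ y ≤ grade ℕ x + w.length := by
  induction w with
  | nil => simp
  | cons h w ih =>
    rw [Walk.length_cons]
    rcases h with h | h <;> have := Order.covBy_iff_add_one_eq.1 (h.grade ℕ) <;> lia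

theorem le_of_grade_add_length_eq {x y : P} (w : (hasse P).Walk x y)
    (hw : grade ℕ x + w.length = grade ℕ y) : x ≤ y := by
  induction w with
  | nil => exact le_rfl
  | cons h w ih =>
    rw [Walk.length_cons] at hw
    have := grade_le_grade_add_length w
    rcases h with h | h <;> have := Order.covBy_iff_add_one_eq.1 (h.grade ℕ)
    · exact h.le.trans (ih (by lia))
    · lia

theorem exists_walk_of_le {x y : P} (h : x ≤ y) :
    ∃ w : (hasse P).Walk x y, grade ℕ x + w.length = grade ℕ y := by
  obtain ⟨n, hn⟩ := Nat.exists_eq_add_of_le (grade_mono (𝕆 := ℕ) h)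
  induction n generalizing x with
  | zero =>
    obtain rfl : x = y := h.eq_of_not_lt fun hlt => (grade_strictMono (𝕆 := ℕ) hlt).ne' hn
    exact ⟨Walk.nil, rfl⟩
  | succ n ih =>
    have hlt : x < y := h.lt_of_ne (by rintro rfl; lia)
    obtain ⟨x', hx, hx'⟩ := exists_covBy_le_of_lt hlt
    have := Order.covBy_iff_add_one_eq.1 (hx.grade ℕ)
    obtain ⟨w, hw⟩ := ih hx' (by lia)
    exact ⟨Walk.cons (hasse_adj.2 (Or.inl hx)) w, by rw [Walk.length_cons]; lia⟩

theorem grade_le_grade_add_edist (x y : P) :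
    (grade ℕ y : ℕ∞) ≤ grade ℕ x + (hasse P).edist x y := by
  by_cases h : (hasse P).edist x y = ⊤
  · simp [h]
  · obtain ⟨w, hw⟩ := exists_walk_of_edist_ne_top h
    rw [← hw]
    exact_mod_cast grade_le_grade_add_length w

theorem grade_add_edist_eq_iff {x y : P} :
    grade ℕ x + (hasse P).edist x y = (grade ℕ y : ℕ∞) ↔ x ≤ y := by
  constructor
  · intro h
    obtain ⟨w, hw⟩ := exists_walk_of_edist_ne_top (G := hasse P) (u := x) (v := y)
      (by rintro htop; simp [htop] at h)
    rw [← hw] at h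
    exact le_of_grade_add_length_eq w (by exact_mod_cast h)
  · intro h
    obtain ⟨w, hw⟩ := exists_walk_of_le h
    refine le_antisymm ?_ (grade_le_grade_add_edist x y)
    rw [← hw, Nat.cast_add]
    gcongr
    exact edist_le w

theorem grade_le_grade_add_len {k : ℕ} (x : Fin (k + 1) → P) :
    (grade ℕ (x (Fin.last k)) : ℕ∞) ≤ grade ℕ (x 0) + len (hasse P) x := by
  induction k with
  | zero => simp
  | succ k ih =>
    rw [len_eq_edist_add, ← add_assoc]
    exact (ih fun i => x i.succ).trans
      (add_le_add_left (grade_le_grade_add_edist (x 0) (x 1)) _)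

theorem grade_add_len_eq_iff {k : ℕ} {x : Fin (k + 1) → P} :
    grade ℕ (x 0) + len (hasse P) x = (grade ℕ (x (Fin.last k)) : ℕ∞) ↔ Monotone x := by
  induction k with
  | zero => simp [len, Subsingleton.monotone]
  | succ k ih =>
    have hmono : Monotone x ↔ x 0 ≤ x 1 ∧ Monotone fun i : Fin (k + 1) => x i.succ := by
      simp only [Fin.monotone_iff_le_succ, Fin.forall_fin_succ (n := k)]
      rfl
    rw [hmono, ← ih, ← grade_add_edist_eq_iff, len_eq_edist_add]
    have hhead := grade_le_grade_add_edist (x 0) (x 1)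
    have htail := grade_le_grade_add_len fun i => x i.succ
    simp only [Fin.succ_last, Fin.succ_zero_eq_one] at htail ⊢
    generalize (hasse P).edist (x 0) (x 1) = e at *
    generalize len (hasse P) (fun i => x i.succ) = L at *
    cases e <;> cases L <;> first | (norm_cast at *; lia) | simp

theorem hasse_connected [OrderBot P] : (hasse P).Connected := by
  have reachable_bot (x : P) : (hasse P).Reachable ⊥ x :=
    (exists_walk_of_le bot_le).choose.reachable
  exact ⟨fun x y => (reachable_bot x).symm.trans (reachable_bot y)⟩

theorem injective_and_len_eq_iff_strictMono {k l : ℕ} {x : Fin (k + 1) → P}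
    (hl : grade ℕ (x 0) + l = grade ℕ (x (Fin.last k))) :
    Function.Injective x ∧ len (hasse P) x = l ↔ StrictMono x := by
  have hlen : len (hasse P) x = l ↔ Monotone x := by
    rw [← grade_add_len_eq_iff, ← hl, Nat.cast_add, (ENat.addLECancellable_natCast _).inj]
  rw [hlen]
  exact ⟨fun h => h.2.strictMono_of_injective h.1, fun h => ⟨h.injective, h.monotone⟩⟩

variable {R : Type v} [CommRing R] {N : Type*} [AddCommGroup N] [Module R N]

theorem intervalCochain_d_eq_zero {k l : ℕ} {a b : P} (hl : grade ℕ a + l = grade ℕ b)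
    {φ : (Fin (k + 1) → P) → N}
    (hφ : ∀ x : Fin (k + 2) → P, StrictMono x → x 0 = a → x (Fin.last (k + 1)) = b →
      ∑ j : Fin k, (-1 : R) ^ ((j : ℕ) + 1) • φ (del j x) = 0)
    (w : EMC R (hasse P) (k + 1) l) :
    intervalCochain R (hasse P) l a b φ (d R (hasse P) k l w) = 0 := by
  suffices h : intervalCochain R (hasse P) l a b φ ∘ₗ d R (hasse P) k l = 0 from
    LinearMap.congr_fun h w
  refine Finsupp.lhom_ext' fun x => LinearMap.ext_ring ?_
  simp only [LinearMap.comp_apply, Finsupp.lsingle_apply, LinearMap.zero_apply]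
  rw [← tupleChain_coe, d_tupleChain R x.2, map_sum]
  simp only [map_smul]
  by_cases hx : x.1 0 = a ∧ x.1 (Fin.last (k + 1)) = b
  · obtain ⟨rfl, rfl⟩ := hx
    have hmono : StrictMono x.1 := (injective_and_len_eq_iff_strictMono hl).1 x.2
    rw [← hφ x.1 hmono rfl rfl]
    refine Finset.sum_congr rfl fun j _ => ?_
    rw [intervalCochain_tupleChain, if_pos ⟨del_apply_zero j _, del_apply_last j _⟩]
    rw [injective_and_len_eq_iff_strictMono (by rwa [del_apply_zero, del_apply_last])]
    exact strictMono_del j hmono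
  · refine Finset.sum_eq_zero fun j _ => ?_
    by_cases hdel : Function.Injective (del j x.1) ∧ len (hasse P) (del j x.1) = l
    · rw [intervalCochain_tupleChain φ hdel, del_apply_zero, del_apply_last, if_neg hx, smul_zero]
    · rw [tupleChain, dif_neg hdel, map_zero, smul_zero]

variable (R) in
theorem d_tupleChain_four {l : ℕ} {a x y b : P} (hl : grade ℕ a + l = grade ℕ b)
    (hax : a < x) (hxy : x < y) (hyb : y < b) :
    d R (hasse P) 2 l (tupleChain R (hasse P) l ![a, x, y, b]) =
      tupleChain R (hasse P) l ![a, x, b] - tupleChain R (hasse P) l ![a, y, b] := by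
  have hmono : StrictMono ![a, x, y, b] := by
    simp [strictMono_vecCons, hax, hxy, hyb]
  rw [d_tupleChain R ((injective_and_len_eq_iff_strictMono hl).2 hmono), Fin.sum_univ_two]
  have del_zero : del 0 ![a, x, y, b] = ![a, y, b] := by
    funext i; fin_cases i <;> rfl
  have del_one : del 1 ![a, x, y, b] = ![a, x, b] := by
    funext i; fin_cases i <;> rfl
  simp [del_zero, del_one, sub_eq_neg_add]

variable (R) in
theorem d_tupleChain_five {l : ℕ} {a x y z b : P} (hl : grade ℕ a + l = grade ℕ b)
    (hax : a < x) (hxy : x < y) (hyz : y < z) (hzb : z < b) :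
    d R (hasse P) 3 l (tupleChain R (hasse P) l ![a, x, y, z, b]) =
      tupleChain R (hasse P) l ![a, x, z, b] - tupleChain R (hasse P) l ![a, y, z, b] -
        tupleChain R (hasse P) l ![a, x, y, b] := by
  have hmono : StrictMono ![a, x, y, z, b] := by
    simp [strictMono_vecCons, hax, hxy, hyz, hzb]
  rw [d_tupleChain R ((injective_and_len_eq_iff_strictMono hl).2 hmono), Fin.sum_univ_three]
  have del_zero : del 0 ![a, x, y, z, b] = ![a, y, z, b] := by
    funext i; fin_cases i <;> rfl
  have del_one : del 1 ![a, x, y, z, b] = ![a, x, z, b] := by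
    funext i; fin_cases i <;> rfl
  have del_two : del 2 ![a, x, y, z, b] = ![a, x, y, b] := by
    funext i; fin_cases i <;> rfl
  simp only [del_zero, del_one, del_two, Fin.val_zero, Fin.val_one, Fin.val_two]
  module

end GradedOrder

/-- The faces of the `Δ`-complex obtained from the join `B * B * B`, whose vertices are the pairs
`(i, b)` with `i : Fin 3`, by dividing out the diagonal translations of `B`, with a least and a
greatest element added. The orbit of the vertices `(i, b)` is `pt i`, that of the edge joining
`(c + 1, a)` to `(c + 2, b)` is `edge c (a - b)`, and `tri v` is the image of the triangle with
vertices `(i, v i)`; translates of a triangle are kept apart, as parallel triangles do not affect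
the first homology. -/
inductive Cell (B : Type u) : Type u
  | bot
  | pt (i : Fin 3)
  | edge (c : Fin 3) (g : B)
  | tri (v : Fin 3 → B)
  | top

namespace Cell

variable {B : Type u}

instance [Finite B] : Finite (Cell B) := by
  let f : Option (Option (Fin 3 ⊕ (Fin 3 × B) ⊕ (Fin 3 → B))) → Cell B := fun s =>
    s.elim bot fun s => s.elim top (Sum.elim pt (Sum.elim (fun e => edge e.1 e.2) tri))
  refine Finite.of_surjective f ?_
  rintro (_ | i | ⟨c, g⟩ | v | _)
  exacts [⟨none, rfl⟩, ⟨some (some (.inl i)), rfl⟩, ⟨some (some (.inr (.inl (c, g)))), rfl⟩,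
    ⟨some (some (.inr (.inr v))), rfl⟩, ⟨some none, rfl⟩]

variable [AddCommGroup B]

/-- The dimension of a cell, shifted so that `bot` has rank `0`. -/
def rank : Cell B → ℕ
  | bot => 0
  | pt _ => 1
  | edge _ _ => 2
  | tri _ => 3
  | top => 4

/-- The incidence relation of the cells. -/
protected def le : Cell B → Cell B → Prop
  | bot, _ | _, top | pt _, tri _ => True
  | pt i, pt j => i = j
  | pt i, edge c _ => i ≠ c
  | edge c g, edge c' g' => c = c' ∧ g = g'
  | edge c g, tri v => g = v (c + 1) - v (c + 2)
  | tri v, tri w => v = w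
  | _, _ => False

theorem eq_or_rank_lt_of_le {x y : Cell B} (h : x.le y) : x = y ∨ rank x < rank y := by
  cases x <;> cases y <;> simp_all [Cell.le, rank]

instance : PartialOrder (Cell B) where
  le := Cell.le
  le_refl x := by cases x <;> simp [Cell.le]
  le_trans x y z := by cases x <;> cases y <;> cases z <;> grind [Cell.le]
  le_antisymm x y hxy hyx := by
    rcases eq_or_rank_lt_of_le hxy with h | h
    · exact h
    · exact ((eq_or_rank_lt_of_le hyx).resolve_right h.not_gt).symm

instance : OrderBot (Cell B) where
  bot := bot
  bot_le _ := trivial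

theorem bot_lt_pt (i : Fin 3) : (bot : Cell B) < pt i := ⟨trivial, id⟩

theorem pt_lt_edge {i c : Fin 3} (h : i ≠ c) (g : B) : pt i < edge c g := ⟨h, id⟩

theorem pt_lt_top (i : Fin 3) : (pt i : Cell B) < top := ⟨trivial, id⟩

theorem pt_lt_tri (i : Fin 3) (v : Fin 3 → B) : pt i < tri v := ⟨trivial, id⟩

theorem edge_lt_tri (c : Fin 3) (v : Fin 3 → B) : edge c (v (c + 1) - v (c + 2)) < tri v :=
  ⟨rfl, id⟩

theorem edge_lt_top (c : Fin 3) (g : B) : edge c g < top := ⟨trivial, id⟩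

theorem tri_lt_top (v : Fin 3 → B) : tri v < top := ⟨trivial, id⟩

theorem add_one_ne (c : Fin 3) : c + 1 ≠ c := by decide +revert

theorem add_two_ne (c : Fin 3) : c + 2 ≠ c := by decide +revert

theorem add_two_ne_add_one (c : Fin 3) : c + 2 ≠ c + 1 := by decide +revert

theorem eq_add_two_of_ne {i c : Fin 3} (h₀ : i ≠ c) (h₁ : i ≠ c + 1) : i = c + 2 := by
  decide +revert

theorem rank_lt_rank {x y : Cell B} (h : x < y) : rank x < rank y :=
  (eq_or_rank_lt_of_le h.le).resolve_left h.ne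

theorem exists_between_of_rank_add_one_lt {x y : Cell B}
    (h : rank x + 1 < rank y) : ∃ z, x < z ∧ z < y := by
  match x, y with
  | bot, edge c g => exact ⟨pt (c + 1), bot_lt_pt _, pt_lt_edge (add_one_ne c) g⟩
  | bot, tri v => exact ⟨pt 0, bot_lt_pt 0, pt_lt_tri 0 v⟩
  | bot, top => exact ⟨pt 0, bot_lt_pt 0, pt_lt_top 0⟩
  | pt i, tri v => exact ⟨edge (i + 1) _, pt_lt_edge (add_one_ne i).symm _, edge_lt_tri (i + 1) v⟩
  | pt i, top => exact ⟨edge (i + 1) 0, pt_lt_edge (add_one_ne i).symm 0, edge_lt_top (i + 1) 0⟩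
  | edge c g, top =>
    have hg : edge c g < tri (Pi.single (c + 1) g) := by
      simpa [add_two_ne_add_one c] using edge_lt_tri c (Pi.single (c + 1) g)
    exact ⟨_, hg, tri_lt_top _⟩

instance : GradeOrder ℕ (Cell B) where
  grade := rank
  grade_strictMono _ _ := rank_lt_rank
  covBy_grade x y h := by
    refine Order.covBy_iff_add_one_eq.2 (le_antisymm (rank_lt_rank h.lt) (not_lt.1 fun hlt => ?_))
    obtain ⟨z, hxz, hzy⟩ := exists_between_of_rank_add_one_lt hlt
    exact h.2 hxz hzy

theorem grade_bot_add_four : grade ℕ (bot : Cell B) + 4 = grade ℕ (top : Cell B) := rfl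

variable (R : Type v) [CommRing R]

/-- The edge `edge c g`, barycentrically subdivided and oriented from `pt (c + 1)` to
`pt (c + 2)`. -/
def edgeChain (c : Fin 3) (g : B) : EMC R (hasse (Cell B)) 3 4 :=
  tupleChain R _ 4 ![bot, pt (c + 1), edge c g, top] -
    tupleChain R _ 4 ![bot, pt (c + 2), edge c g, top]

theorem d_edgeChain (c : Fin 3) (g : B) :
    d R (hasse (Cell B)) 2 4 (edgeChain R c g) =
      tupleChain R _ 4 ![bot, pt (c + 1), top] - tupleChain R _ 4 ![bot, pt (c + 2), top] := by
  rw [edgeChain, map_sub,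
    d_tupleChain_four R grade_bot_add_four (bot_lt_pt _) (pt_lt_edge (add_one_ne c) g)
      (edge_lt_top c g),
    d_tupleChain_four R grade_bot_add_four (bot_lt_pt _) (pt_lt_edge (add_two_ne c) g)
      (edge_lt_top c g), sub_sub_sub_cancel_right]

theorem sum_edgeChain_mem_range_d (v : Fin 3 → B) :
    ∑ c, edgeChain R c (v (c + 1) - v (c + 2)) ∈
      LinearMap.range (d R (hasse (Cell B)) 3 4) := by
  let flag (i c : Fin 3) :=
    tupleChain R (hasse (Cell B)) 4
      ![bot, pt i, edge c (v (c + 1) - v (c + 2)), tri v, top]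
  let ptFlag (i : Fin 3) := tupleChain R (hasse (Cell B)) 4 ![bot, pt i, tri v, top]
  refine ⟨∑ c, (flag (c + 2) c - flag (c + 1) c), ?_⟩
  have d_flag_sub (c : Fin 3) :
      d R (hasse (Cell B)) 3 4 (flag (c + 2) c - flag (c + 1) c) =
        edgeChain R c (v (c + 1) - v (c + 2)) + (ptFlag (c + 2) - ptFlag (c + 1)) := by
    rw [map_sub,
      d_tupleChain_five R grade_bot_add_four (bot_lt_pt _) (pt_lt_edge (add_two_ne c) _)
        (edge_lt_tri c v) (tri_lt_top v),
      d_tupleChain_five R grade_bot_add_four (bot_lt_pt _) (pt_lt_edge (add_one_ne c) _)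
        (edge_lt_tri c v) (tri_lt_top v), edgeChain]
    abel
  have sum_ptFlag_shift (a : Fin 3) : ∑ c, ptFlag (c + a) = ∑ c, ptFlag c :=
    Equiv.sum_comp (Equiv.addRight a) ptFlag
  rw [map_sum, Finset.sum_congr rfl fun c _ => d_flag_sub c, Finset.sum_add_distrib,
    Finset.sum_sub_distrib, sum_ptFlag_shift, sum_ptFlag_shift, sub_self, add_zero]

theorem edgeChain_add_add_mem_range_d (g h : B) :
    edgeChain R 0 (g + h) + edgeChain R 1 (-g) + edgeChain R 2 (-h) ∈
      LinearMap.range (d R (hasse (Cell B)) 3 4) := by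
  simpa [Fin.sum_univ_three, add_comm] using sum_edgeChain_mem_range_d R ![0, h, -g]

/-- The loop of `edge 0 g` followed by the reverse of `edge 0 0`. -/
def loopChain (g : B) : EMC R (hasse (Cell B)) 3 4 := edgeChain R 0 g - edgeChain R 0 0

theorem d_loopChain (g : B) : d R (hasse (Cell B)) 2 4 (loopChain R g) = 0 := by
  rw [loopChain, map_sub, d_edgeChain, d_edgeChain, sub_self]

theorem loopChain_add_sub_mem_range_d (g h : B) :
    loopChain R (g + h) - (loopChain R g + loopChain R h) ∈
      LinearMap.range (d R (hasse (Cell B)) 3 4) := by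
  -- The edges opposite `pt 1` and `pt 2` cancel in the alternating sum over four triangles.
  have alternating_sum_mem := add_mem
    (sub_mem (edgeChain_add_add_mem_range_d R g h) (edgeChain_add_add_mem_range_d R g 0))
    (sub_mem (edgeChain_add_add_mem_range_d R 0 0) (edgeChain_add_add_mem_range_d R 0 h))
  convert alternating_sum_mem using 1
  simp only [loopChain, add_zero, zero_add]
  abel

variable (B) in
/-- The homology classes of the loops formed by two parallel edges. -/
def loopClass : B →+ EMH R (hasse (Cell B)) 3 4 :=
  AddMonoidHom.mk' (fun g => emhClass R _ 2 4 ⟨loopChain R g, d_loopChain R g⟩) fun g h => by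
    rw [← map_add, ← sub_eq_zero, ← map_sub, emhClass_eq_zero_iff]
    exact loopChain_add_sub_mem_range_d R g h

/-- The cocycle on the flags of cells which classifies the covering of the quotient by `B * B * B`.
With `pt i` lifted to `(i, 0)`, `edge c g` to the edge from `(c + 1, g)` to `(c + 2, 0)` and `tri v`
to the triangle with vertices `(i, v i)`, the value at `x < y` is the translation taking the lift
of `x` into that of `y`. -/
def cocycle : Cell B → Cell B → B
  | pt i, edge c g => if i = c + 1 then g else 0
  | edge c _, tri v => v (c + 2)
  | pt i, tri v => v i
  | _, _ => 0

theorem cocycle_add_cocycle {x y z : Cell B} (hx : bot < x) (hxy : x < y) (hyz : y < z)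
    (hz : z < top) : cocycle x y + cocycle y z = cocycle x z := by
  have := rank_lt_rank hx
  have := rank_lt_rank hxy
  have := rank_lt_rank hyz
  have := rank_lt_rank hz
  match x, y, z with
  | pt i, edge c g, tri v =>
    have hi : i ≠ c := hxy.le
    have hg : g = v (c + 1) - v (c + 2) := hyz.le
    by_cases h : i = c + 1
    · simp [cocycle, h, hg]
    · obtain rfl := eq_add_two_of_ne hi h
      simp [cocycle]

variable [Module R B]

variable (B) in
/-- The cochain on `EMC_{3,4}` which evaluates `cocycle` on the two inner cells. -/
def cochain : EMC R (hasse (Cell B)) 3 4 →ₗ[R] B :=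
  intervalCochain R _ 4 bot top fun x => cocycle (x 1) (x 2)

theorem cochain_d (w : EMC R (hasse (Cell B)) 4 4) : cochain B R (d R _ 3 4 w) = 0 := by
  refine intervalCochain_d_eq_zero grade_bot_add_four (fun x hx hbot htop => ?_) w
  have cocycle_eq : cocycle (x 1) (x 2) + cocycle (x 2) (x 3) = cocycle (x 1) (x 3) :=
    cocycle_add_cocycle (hbot ▸ hx (by decide)) (hx (by decide)) (hx (by decide))
      (htop ▸ hx (by decide))
  have cocycle_del_zero : cocycle (del 0 x 1) (del 0 x 2) = cocycle (x 2) (x 3) := rfl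
  have cocycle_del_one : cocycle (del 1 x 1) (del 1 x 2) = cocycle (x 1) (x 3) := rfl
  have cocycle_del_two : cocycle (del 2 x 1) (del 2 x 2) = cocycle (x 1) (x 2) := rfl
  rw [Fin.sum_univ_three, cocycle_del_zero, cocycle_del_one, cocycle_del_two, ← cocycle_eq]
  simp only [Fin.val_zero, Fin.val_one, Fin.val_two]
  module

theorem cochain_tupleChain {i c : Fin 3} (h : i ≠ c) (g : B) :
    cochain B R (tupleChain R _ 4 ![bot, pt i, edge c g, top]) = if i = c + 1 then g else 0 := by
  have hmono : StrictMono ![bot, pt i, edge c g, top] := by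
    simp [bot_lt_pt i, pt_lt_edge h g, edge_lt_top c g]
  rw [cochain, intervalCochain_tupleChain _
    ((injective_and_len_eq_iff_strictMono grade_bot_add_four).2 hmono), if_pos ⟨rfl, rfl⟩]
  rfl

theorem cochain_edgeChain (c : Fin 3) (g : B) : cochain B R (edgeChain R c g) = g := by
  rw [edgeChain, map_sub, cochain_tupleChain R (add_one_ne c), cochain_tupleChain R (add_two_ne c),
    if_pos rfl, if_neg (add_two_ne_add_one c), sub_zero]

theorem cochain_loopChain (g : B) : cochain B R (loopChain R g) = g := by
  rw [loopChain, map_sub, cochain_edgeChain, cochain_edgeChain, sub_zero]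

theorem loopClass_injective : Function.Injective (loopClass B R) := by
  rw [injective_iff_map_eq_zero]
  intro g hg
  obtain ⟨w, hw : d R _ 3 4 w = loopChain R g⟩ := (emhClass_eq_zero_iff _).1 hg
  rw [← cochain_loopChain R g, ← hw, cochain_d]

end Cell

theorem directSum_coprod_of_injective {ι : Type*} [DecidableEq ι] {β : ι → Type*}
    [∀ i, AddCommMonoid (β i)] {i j : ι} (h : i ≠ j) :
    Function.Injective ((DirectSum.of β i).coprod (DirectSum.of β j)) := by
  refine Function.LeftInverse.injective (g := fun s => (s i, s j)) fun ⟨x, y⟩ => ?_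
  simp [DirectSum.of_eq_of_ne, h, h.symm]

theorem exists_injective_to_TotalEMH (R : Type v) [CommRing R] (B : Type u) [AddCommGroup B]
    [Module R B] :
    ∃ f : (B →₀ R) × B →+ TotalEMH R (hasse (Cell B)), Function.Injective f := by
  let vertexClass : (B →₀ R) →+ EMH R (hasse (Cell B)) 0 0 :=
    (vertexHomologyEquiv R _).toAddMonoidHom.comp (Finsupp.mapDomain.addMonoidHom (Cell.edge 0))
  have vertexClass_injective : Function.Injective vertexClass :=
    (vertexHomologyEquiv R _).injective.comp
      (Finsupp.mapDomain_injective fun _ _ h => (Cell.edge.inj h).2)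
  let inclusion (p : ℕ × ℕ) : EMH R (hasse (Cell B)) p.1 p.2 →+ TotalEMH R (hasse (Cell B)) :=
    DirectSum.of (fun p : ℕ × ℕ => EMH R _ p.1 p.2) p
  exact ⟨((inclusion (0, 0)).coprod (inclusion (3, 4))).comp
      (vertexClass.prodMap (Cell.loopClass B R)),
    (directSum_coprod_of_injective (by simp)).comp
      (vertexClass_injective.prodMap (Cell.loopClass_injective R))⟩

theorem exists_injective_to_finsupp_prod (A : Type*) [AddCommGroup A] [AddGroup.FG A] :
    ∃ (B : Type) (_ : AddCommGroup B) (_ : Finite B) (f : A →+ (B →₀ ℤ) × B),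
      Function.Injective f := by
  obtain ⟨n, ι, _, p, hp, e, ⟨φ⟩⟩ := AddCommGroup.equiv_free_prod_directSum_zmod A
  have (i : ι) : NeZero (p i ^ e i) := ⟨pow_ne_zero _ (hp i).ne_zero⟩
  let T := ⨁ i : ι, ZMod (p i ^ e i)
  have : Finite T := Finite.of_injective (fun x i => x i) DFunLike.coe_injective
  let basis (i : Fin n) : T × ZMod (n + 1) := (0, i.castSucc)
  have basis_injective : Function.Injective basis := fun i j h =>
    Fin.castSucc_injective n (congrArg Prod.snd h)
  let f : (Fin n →₀ ℤ) × T →+ (T × ZMod (n + 1) →₀ ℤ) × T × ZMod (n + 1) :=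
    (Finsupp.mapDomain.addMonoidHom basis).prodMap (AddMonoidHom.inl T (ZMod (n + 1)))
  have f_injective : Function.Injective f :=
    (Finsupp.mapDomain_injective basis_injective).prodMap (Prod.mk_left_injective 0)
  exact ⟨T × ZMod (n + 1), inferInstance, inferInstance, f.comp φ.toAddMonoidHom,
    f_injective.comp φ.injective⟩

end EulerianMagnitude

end

theorem mainTheorem9 (A : Type*) [AddCommGroup A] [AddGroup.FG A] :
    ∃ (V : Type) (_ : Finite V) (G : SimpleGraph V), G.Connected ∧
      ∃ H : AddSubgroup (EulerianMagnitude.TotalEMH ℤ G), Nonempty (A ≃+ H) := by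
  obtain ⟨B, _, _, f, hf⟩ := EulerianMagnitude.exists_injective_to_finsupp_prod A
  obtain ⟨g, hg⟩ := EulerianMagnitude.exists_injective_to_TotalEMH ℤ B
  exact ⟨EulerianMagnitude.Cell B, inferInstance, SimpleGraph.hasse (EulerianMagnitude.Cell B),
    EulerianMagnitude.hasse_connected, (g.comp f).range,
    ⟨AddMonoidHom.ofInjective (f := g.comp f) (hg.comp hf)⟩⟩
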